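/- Let $f_1,\dots,f_n:\mathbb{R}^d\to\mathbb{R}$ ($n\ge 1$) be convex, differentiable and $L$-smooth (i.e. $\nabla f_i$ is $L$-Lipschitz), $L>0$, let $\sigma>0$, $\kappa=1+L/\sigma$, and let $\theta_\star$ be the minimizer of $\sum_{i=1}^n\big[f_i(\theta)+\frac{\sigma}{2}\|\theta\|^2\big]$. Consider the following algorithm (Token Gradient Descent with a single token, on the complete graph over the $n$ nodes, $p_{\rm comp}=p_{\rm comm}=\frac12$). Put $$\tilde\sigma=\frac{n}{n+1}\sigma,\quad \eta=\min\Big(\frac{\tilde\sigma p_{\rm comm}}{2n},\frac{p_{\rm comp}}{n\alpha(1+L/\tilde\sigma)}\Big),\quad \rho_{\rm comm}=\frac{n\eta}{p_{\rm comm}\tilde\sigma},\quad \rho_{\rm comp}=\frac{n\alpha\eta}{p_{\rm comp}},$$ with $\alpha>0$ specified below. Start from arbitrary $z_0^{(i)}\in\mathbb{R}^d$, with $\theta_0^{(i)}=-\nabla f_i(z_0^{(i)})/\tilde\sigma$ and $\theta_0^{\rm token}=0$. At each iteration $t$, independently of the past, - with probability $p_{\rm comm}$ the token jumps to a uniformly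 random node $i$, and $\theta_{t+1}^{\rm token}=\theta_t^{\rm token}-\rho_{\rm comm}(\theta_t^{\rm token}-\theta_t^{(i)})$, $\theta_{t+1}^{(i)}=\theta_t^{(i)}+\rho_{\rm comm}(\theta_t^{\rm token}-\theta_t^{(i)})$; - otherwise (with probability $p_{\rm comp}$) a uniformly random node $i$ makes a gradient step: $z_{t+1}^{(i)}=(1-\rho_{\rm comp})z_t^{(i)}+\rho_{\rm comp}\theta_t^{(i)}$, $\theta_{t+1}^{(i)}=\theta_t^{(i)}-\frac1{\tilde\sigma}\big(\nabla f_i(z_{t+1}^{(i)})-\nabla f_i(z_t^{(i)})\big)$. All other variables are left unchanged. Write $\|\theta_t-\theta_\star\|^2=\sum_{i=1}^n\|\theta_t^{(i)}-\theta_\star\|^2+\|\theta_t^{\rm token}-\theta_\star\|^2$. For every $c>0$ there is a constant $C>0$, depending only on $c$, such that the following holds in either of the two cases (i) $\alpha=2/L$ and $L\ge c\,\sigma$, or (ii) $\alpha=2/(\tilde\sigma+L)$ (and $L>0$ arbitrary; in this case $C$ may be taken to be absolute). There is $C_0>0$, depending on the problem and the initialization but not on $\varepsilon$, such that for all $\varepsilon>0$,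 with $$B_{\rm comp}=C\,\kappa\,\big(1+\log^+(C_0/\varepsilon)\big),\qquad B_{\rm comm}=C\,n\kappa\,\big(1+\log^+(C_0/\varepsilon)\big),\qquad \log^+x=\max(0,\log x):$$ 1. there is a number of iterations $T$ such that $\mathbb{E}\|\theta_t-\theta_\star\|^2\le\varepsilon$ for all $t\ge T$, and in the first $T$ iterations the expected number of gradient steps of each node is at most $B_{\rm comp}$, and the expected number of token jumps is at most $B_{\rm comm}$; 2. almost surely $\|\theta_t-\theta_\star\|^2\le\varepsilon$ for some $t$, and before the first such $t$ the expected number of gradient steps of each node is at most $B_{\rm comp}$ and the expected number of token jumps is at most $B_{\rm comm}$. In other words, $T_{\rm comp}=O(\kappa\log\varepsilon^{-1})$ and $T_{\rm comm}=O(n\kappa\log\varepsilon^{-1})$. -/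

import Mathlib

open MeasureTheory ProbabilityTheory
open scoped Gradient ENNReal

noncomputable section

namespace TokenGD

/-- The parameter space `ℝ^d` with its Euclidean norm. -/
abbrev Vec (d : ℕ) : Type := EuclideanSpace ℝ (Fin d)

/-- `f` is convex, differentiable and `L`-smooth (its gradient is `L`-Lipschitz) on `ℝ^d`. -/
structure ConvexSmooth {d : ℕ} (L : ℝ) (f : Vec d → ℝ) : Prop where
  convex : ConvexOn ℝ Set.univ f
  diff : Differentiable ℝ f
  smooth : ∀ x y : Vec d, ‖∇ f x - ∇ f y‖ ≤ L * ‖x - y‖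

/-- The objective `∑ i, (f i θ + σ / 2 * ‖θ‖ ^ 2)`. -/
def objective {n d : ℕ} (σ : ℝ) (f : Fin n → Vec d → ℝ) (θ : Vec d) : ℝ :=
  ∑ i, (f i θ + σ / 2 * ‖θ‖ ^ 2)

/-- The condition number `κ = 1 + L / σ`. -/
def kappa (σ L : ℝ) : ℝ := 1 + L / σ

/-! Parameters of the algorithm, for `n` nodes and `K` tokens. -/

/-- `σ̃ = n / (n + K) * σ`. -/
def sigmaT (n K : ℕ) (σ : ℝ) : ℝ := (n : ℝ) / ((n : ℝ) + (K : ℝ)) * σ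

/-- The value `2 K / L` of `α`. -/
def alphaL (K : ℕ) (L : ℝ) : ℝ := 2 * (K : ℝ) / L

/-- The value `2 K / (σ̃ + L)` of `α`. -/
def alphaSL (n K : ℕ) (σ L : ℝ) : ℝ := 2 * (K : ℝ) / (sigmaT n K σ + L)

/-- The step size `η`. -/
def eta (n K : ℕ) (σ L α pcomm pcomp : ℝ) : ℝ :=
  min (sigmaT n K σ * pcomm / (2 * (n : ℝ) * (K : ℝ)))
    (pcomp / ((n : ℝ) * α * (1 + L / sigmaT n K σ)))

/-- `ρ_comm = n K η / (p_comm σ̃)`. -/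
def rhoComm (n K : ℕ) (σ L α pcomm pcomp : ℝ) : ℝ :=
  (n : ℝ) * (K : ℝ) * eta n K σ L α pcomm pcomp / (pcomm * sigmaT n K σ)

/-- `ρ_comp = n α η / p_comp`. -/
def rhoComp (n K : ℕ) (σ L α pcomm pcomp : ℝ) : ℝ :=
  (n : ℝ) * α * eta n K σ L α pcomm pcomp / pcomp

/-- The variables of the algorithm: local parameters `θ^(i)`, token parameters `θ^(token,k)`,
virtual parameters `z^(i)`. -/
structure State (n K d : ℕ) where
  node : Fin n → Vec d
  token : Fin K → Vec d
  z : Fin n → Vec d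

/-- The random choice made in one iteration: `Sum.inl (i, k)` is a communication step in which
token `k` jumps to node `i` (any node can be reached, the communication graph being complete);
`Sum.inr i` is a computation step (gradient step) at node `i`. -/
abbrev Choice (n K : ℕ) : Type := (Fin n × Fin K) ⊕ Fin n

/-- The probability of each choice: a communication step is made with probability `pcomm`, and then
`i` and `k` are independent and uniform; otherwise `i` is uniform. -/
def choiceProb (n K : ℕ) (pcomm pcomp : ℝ) : Choice n K → ℝ
  | Sum.inl _ => pcomm / ((n : ℝ) * (K : ℝ))
  | Sum.inr _ => pcomp / (n : ℝ)

/-- Initialization from an arbitrary `z₀`. -/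
def init {n d : ℕ} (K : ℕ) (σ : ℝ) (f : Fin n → Vec d → ℝ) (z₀ : Fin n → Vec d) : State n K d where
  node := fun i => -((sigmaT n K σ)⁻¹ • ∇ (f i) (z₀ i))
  token := fun _ => 0
  z := z₀

/-- Communication update: node `i` and token `k` move towards each other. -/
def commUpdate {n K d : ℕ} (ρ : ℝ) (S : State n K d) (i : Fin n) (k : Fin K) : State n K d where
  node := Function.update S.node i (S.node i + ρ • (S.token k - S.node i))
  token := Function.update S.token k (S.token k - ρ • (S.token k - S.node i))
  z := S.z

/-- The new virtual parameter in a computation update at node `i`. -/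
def zNew {n K d : ℕ} (ρ : ℝ) (S : State n K d) (i : Fin n) : Vec d :=
  (1 - ρ) • S.z i + ρ • S.node i

/-- Computation update at node `i`. -/
def compUpdate {n K d : ℕ} (σt ρ : ℝ) (f : Fin n → Vec d → ℝ) (S : State n K d) (i : Fin n) :
    State n K d where
  node := Function.update S.node i
    (S.node i - σt⁻¹ • (∇ (f i) (zNew ρ S i) - ∇ (f i) (S.z i)))
  token := S.token
  z := Function.update S.z i (zNew ρ S i)

/-- One iteration of token gradient descent. -/
def step {n K d : ℕ} (σ L α pcomm pcomp : ℝ) (f : Fin n → Vec d → ℝ) (S : State n K d) :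
    Choice n K → State n K d
  | Sum.inl (i, k) => commUpdate (rhoComm n K σ L α pcomm pcomp) S i k
  | Sum.inr i => compUpdate (sigmaT n K σ) (rhoComp n K σ L α pcomm pcomp) f S i

/-- The state after `t` iterations, along the sequence of choices `a`. -/
def iterate {n K d : ℕ} (σ L α pcomm pcomp : ℝ) (f : Fin n → Vec d → ℝ) (z₀ : Fin n → Vec d)
    (a : ℕ → Choice n K) : ℕ → State n K d
  | 0 => init K σ f z₀
  | t + 1 => step σ L α pcomm pcomp f (iterate σ L α pcomm pcomp f z₀ a t) (a t)

/-- The squared error `‖θ - θ⋆‖²` of all local and token parameters together. -/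
def State.err {n K d : ℕ} (S : State n K d) (θs : Vec d) : ℝ :=
  ∑ i, ‖S.node i - θs‖ ^ 2 + ∑ k, ‖S.token k - θs‖ ^ 2

/-- The random choices `a 0, a 1, …` are independent, each with the law `choiceProb`. -/
structure IsSampling {n K : ℕ} {Ω : Type*} [MeasurableSpace Ω] (P : Measure Ω) (pcomm pcomp : ℝ)
    (a : ℕ → Ω → Choice n K) : Prop where
  meas : ∀ t, Measurable (a t)
  indep : iIndepFun a P
  law : ∀ t s, P.real (a t ⁻¹' {s}) = choiceProb n K pcomm pcomp s

/-- Number of gradient steps made by node `i` in the first `T` iterations. -/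
def gradSteps {n K : ℕ} (a : ℕ → Choice n K) (i : Fin n) (T : ℕ) : ℕ :=
  ((Finset.range T).filter fun t => a t = Sum.inr i).card

/-- Number of communication steps (token jumps) in the first `T` iterations. -/
def jumps {n K : ℕ} (a : ℕ → Choice n K) (T : ℕ) : ℕ :=
  ((Finset.range T).filter fun t => (a t).isLeft).card

open Classical in
/-- Number (possibly `∞`) of gradient steps made by node `i` before the first time at which the
error sequence `e` is at most `ε`. -/
def gradStepsUntil {n K : ℕ} (a : ℕ → Choice n K) (e : ℕ → ℝ) (ε : ℝ) (i : Fin n) : ℝ≥0∞ :=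
  ∑' t, if (∀ s ≤ t, ε < e s) ∧ a t = Sum.inr i then 1 else 0

open Classical in
/-- Number (possibly `∞`) of token jumps made before the first time at which the error sequence `e`
is at most `ε`. -/
def jumpsUntil {n K : ℕ} (a : ℕ → Choice n K) (e : ℕ → ℝ) (ε : ℝ) : ℝ≥0∞ :=
  ∑' t, if (∀ s ≤ t, ε < e s) ∧ (a t).isLeft then 1 else 0

end TokenGD

end

noncomputable section

namespace TokenGD

/-! ### Bregman divergences and gradients of smooth convex functions. -/

section ConvexSmooth

open scoped RealInnerProductSpace

/-! The algorithm is a randomized dual method. Each node carries a dual variable `σ̃ θ + ∇ f z`; a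
computation step leaves it fixed, and a communication step changes it and `σ̃` times the token by
opposite amounts. Hence the linear relation `TokenBalance` between token and dual variables is
invariant. It holds at the start because `θ₀` makes all dual variables vanish and because `σ̃`
splits the total regularization `n σ` evenly over the `n` nodes and the token.

The Lyapunov function `potential` adds the squared dual distance, `α⁻¹` times the Bregman
divergences of the `z`, and `s = 2 n η` times the dual suboptimality. The parameters satisfy `σ̃
ρ_comm = α⁻¹ ρ_comp = s`, so in either kind of step the quadratic increments are absorbed by the
suboptimality (`nodePotential_comm_le`, `nodePotential_comp_le`) and only linear terms remain. By
the balance relation these average to `-s / (2 n) * Q`, where `Q` collects the squared errors and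
the symmetrized Bregman divergences (`TokenBalance.sum_inner_eq`). Since the potential is at most
`(σ̃ + 2 L) * Q` (`nodePotential_le_mul`), it contracts in expectation by the factor `1 - η / (σ̃ +
2 L)`.

The choice of `α` keeps `η` of order `σ̃ / n`, so the inverse rate is `O(n κ)`. Markov's inequality
turns the decay into a bound on the expected hitting time, and independence of each choice from the
past gives a node `1 / (2 n)` gradient steps per iteration on average. -/

/-- The Bregman divergence `f x - f y - ⟪∇ f y, x - y⟫`. -/
def bregman {d : ℕ} (f : Vec d → ℝ) (x y : Vec d) : ℝ := f x - f y - ⟪∇ f y, x - y⟫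

variable {n d : ℕ} {L : ℝ} {f : Vec d → ℝ}

theorem hasDerivAt_comp_line (hf : Differentiable ℝ f) (x v : Vec d) (t : ℝ) :
    HasDerivAt (fun s : ℝ => f (x + s • v)) ⟪∇ f (x + t • v), v⟫ t := by
  have h1 : HasDerivAt (fun s : ℝ => x + s • v) v t := by
    simpa using ((hasDerivAt_id t).smul_const v).const_add x
  have h2 := ((hf (x + t • v)).hasFDerivAt).comp_hasDerivAt t h1
  rw [inner_gradient_left]
  exact h2

theorem le_quadratic_of_lipschitz_gradient (hf : Differentiable ℝ f)
    (hL : ∀ x y : Vec d, ‖∇ f x - ∇ f y‖ ≤ L * ‖x - y‖) (x v : Vec d) :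
    f (x + v) ≤ f x + ⟪∇ f x, v⟫ + L / 2 * ‖v‖ ^ 2 := by
  -- `f` along the segment minus its quadratic model; the Lipschitz bound makes the derivative
  -- nonpositive on `[0, 1]`.
  set g : ℝ → ℝ := fun t => f (x + t • v) - (t * ⟪∇ f x, v⟫ + L / 2 * ‖v‖ ^ 2 * t ^ 2) with hg
  have hder : ∀ t, HasDerivAt g
      (⟪∇ f (x + t • v), v⟫ - (⟪∇ f x, v⟫ + L * ‖v‖ ^ 2 * t)) t := by
    intro t
    have h2 : HasDerivAt (fun t : ℝ => t * ⟪∇ f x, v⟫ + L / 2 * ‖v‖ ^ 2 * t ^ 2)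
        (⟪∇ f x, v⟫ + L * ‖v‖ ^ 2 * t) t := by
      refine (((hasDerivAt_id t).mul_const ⟪∇ f x, v⟫).add
        ((hasDerivAt_pow 2 t).const_mul (L / 2 * ‖v‖ ^ 2))).congr_deriv ?_
      norm_num
      ring
    exact (hasDerivAt_comp_line hf x v t).sub h2
  have hanti : AntitoneOn g (Set.Icc 0 1) := by
    refine antitoneOn_of_deriv_nonpos (convex_Icc 0 1)
      (fun t _ => (hder t).continuousAt.continuousWithinAt)
      (fun t _ => (hder t).differentiableAt.differentiableWithinAt) fun t ht => ?_
    rw [interior_Icc] at ht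
    rw [(hder t).deriv]
    have h1 : ⟪∇ f (x + t • v) - ∇ f x, v⟫ ≤ ‖∇ f (x + t • v) - ∇ f x‖ * ‖v‖ :=
      real_inner_le_norm _ _
    have h2 := hL (x + t • v) x
    rw [add_sub_cancel_left, norm_smul, Real.norm_of_nonneg ht.1.le] at h2
    rw [inner_sub_left] at h1
    nlinarith [mul_le_mul_of_nonneg_right h2 (norm_nonneg v)]
  have h := hanti (Set.left_mem_Icc.2 zero_le_one) (Set.right_mem_Icc.2 zero_le_one) zero_le_one
  simp only [hg, one_smul, zero_smul, add_zero] at h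
  linarith

theorem ConvexSmooth.bregman_nonneg (hf : ConvexSmooth L f) (x y : Vec d) :
    0 ≤ bregman f x y := by
  have hc : ConvexOn ℝ Set.univ fun s : ℝ => f (y + s • (x - y)) := by
    have := hf.convex.comp_affineMap (AffineMap.lineMap (k := ℝ) y x)
    simpa [Function.comp_def, AffineMap.lineMap_apply_module', add_comm] using this
  have h := hc.le_slope_of_hasDerivAt (Set.mem_univ 0) (Set.mem_univ 1) zero_lt_one
    (hasDerivAt_comp_line hf.diff y (x - y) 0)
  simp only [slope_def_field, one_smul, zero_smul, add_zero, sub_zero, div_one,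
    add_sub_cancel] at h
  simp only [bregman]
  linarith

/-- Cocoercivity: at the point `x - L⁻¹ • g`, bound `f` from above by the quadratic model at `x` and
from below by the tangent at `y`. -/
theorem ConvexSmooth.norm_gradient_sub_sq_le (hL : 0 < L) (hf : ConvexSmooth L f) (x y : Vec d) :
    ‖∇ f x - ∇ f y‖ ^ 2 ≤ 2 * L * bregman f x y := by
  set g := ∇ f x - ∇ f y with hg
  have h1 := le_quadratic_of_lipschitz_gradient hf.diff hf.smooth x (-(L⁻¹ • g))
  have h2 := hf.bregman_nonneg (x + -(L⁻¹ • g)) y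
  have h3 : ⟪∇ f x, g⟫ - ⟪∇ f y, g⟫ = ‖g‖ ^ 2 := by
    rw [← inner_sub_left, real_inner_self_eq_norm_sq]
  have h4 : x + -(L⁻¹ • g) - y = (x - y) + -(L⁻¹ • g) := by abel
  simp only [bregman, h4, inner_add_right, inner_neg_right, inner_smul_right, norm_neg, norm_smul,
    Real.norm_of_nonneg (inv_pos.2 hL).le, mul_pow] at h1 h2 ⊢
  have h5 : L / 2 * (L⁻¹ ^ 2 * ‖g‖ ^ 2) = L⁻¹ * ‖g‖ ^ 2 / 2 := by
    field_simp
  have h6 : L⁻¹ * ‖g‖ ^ 2 / 2 ≤ f x - f y - ⟪∇ f y, x - y⟫ := by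
    have h7 : L⁻¹ * ⟪∇ f x, g⟫ - L⁻¹ * ⟪∇ f y, g⟫ = L⁻¹ * ‖g‖ ^ 2 := by rw [← mul_sub, h3]
    linarith
  calc ‖g‖ ^ 2 = 2 * L * (L⁻¹ * ‖g‖ ^ 2 / 2) := by field_simp
    _ ≤ _ := by gcongr

theorem sum_gradient_of_isMinOn {σ : ℝ} {f : Fin n → Vec d → ℝ} {θs : Vec d}
    (hf : ∀ i, Differentiable ℝ (f i)) (hmin : IsMinOn (objective σ f) Set.univ θs) :
    ∑ i, ∇ (f i) θs = -((n * σ) • θs) := by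
  refine ext_inner_right ℝ fun v => ?_
  have hd : HasDerivAt (fun s : ℝ => objective σ f (θs + s • v))
      (∑ i, (⟪∇ (f i) θs, v⟫ + σ * ⟪θs, v⟫)) 0 := by
    unfold objective
    refine HasDerivAt.fun_sum fun i _ => ?_
    refine HasDerivAt.add ?_ ?_
    · simpa using hasDerivAt_comp_line (hf i) θs v 0
    · have h1 : HasDerivAt (fun s : ℝ => θs + s • v) v 0 := by
        simpa using ((hasDerivAt_id (0 : ℝ)).smul_const v).const_add θs
      refine (h1.norm_sq.const_mul (σ / 2)).congr_deriv ?_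
      simp only [zero_smul, add_zero]
      ring
  have hm : IsLocalMin (fun s : ℝ => objective σ f (θs + s • v)) 0 := by
    refine Filter.Eventually.of_forall fun s => ?_
    simpa using hmin (Set.mem_univ (θs + s • v))
  have := hm.hasDerivAt_eq_zero hd
  rw [Finset.sum_add_distrib, Finset.sum_const, Finset.card_univ, Fintype.card_fin,
    nsmul_eq_mul] at this
  rw [sum_inner, inner_neg_left, real_inner_smul_left]
  linarith

end ConvexSmooth

/-! ### Functions of finitely many independent choices, and drift of a Markov chain. -/

section Sampling

variable {Ω γ β : Type*} [MeasurableSpace Ω] {P : Measure Ω} {a : ℕ → Ω → γ} {t : ℕ}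

/-- Factoring through the first `t` coordinates leaves, for finite `γ`, a function on a finite
space; its measurability and integrability are then automatic. -/
theorem exists_eq_comp_restrict_of_dependsOn [Nonempty γ] {F : (ℕ → γ) → β}
    (hF : DependsOn F (Set.Iio t)) :
    ∃ u : (Finset.range t → γ) → β, ∀ x, F x = u fun i => x i := by
  classical
  refine ⟨fun y => F fun i => if h : i ∈ Finset.range t then y ⟨i, h⟩ else Classical.arbitrary γ,
    fun x => hF fun i hi => ?_⟩
  rw [dif_pos (Finset.mem_range.2 hi)]

variable [MeasurableSpace γ] [MeasurableSingletonClass γ] [Fintype γ]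

theorem measurable_of_dependsOn [MeasurableSpace β] [Nonempty γ] (ha : ∀ t, Measurable (a t))
    {F : (ℕ → γ) → β} (hF : DependsOn F (Set.Iio t)) :
    Measurable fun ω => F fun s => a s ω := by
  obtain ⟨u, hu⟩ := exists_eq_comp_restrict_of_dependsOn hF
  simp only [hu]
  exact (measurable_of_finite u).comp (measurable_pi_lambda _ fun i => ha i)

theorem measurableSet_forall_lt [Nonempty γ] (ha : ∀ t, Measurable (a t))
    {E : ℕ → (ℕ → γ) → ℝ} (hE : ∀ t, DependsOn (E t) (Set.Iio t)) (ε : ℝ) (t : ℕ) :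
    MeasurableSet {ω | ∀ s ≤ t, ε < E s fun r => a r ω} := by
  simp only [Set.ofPred_forall]
  exact MeasurableSet.iInter fun s => MeasurableSet.iInter fun _ =>
    measurableSet_lt measurable_const (measurable_of_dependsOn ha (hE s))

theorem integrable_of_dependsOn [IsProbabilityMeasure P] [Nonempty γ] (ha : ∀ t, Measurable (a t)) {F : (ℕ → γ) → ℝ}
    (hF : DependsOn F (Set.Iio t)) : Integrable (fun ω => F fun s => a s ω) P := by
  obtain ⟨u, hu⟩ := exists_eq_comp_restrict_of_dependsOn hF
  simp only [hu]
  have hX : Measurable fun ω => fun i : Finset.range t => a i ω :=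
    measurable_pi_lambda _ fun i => ha i
  have := Measure.isProbabilityMeasure_map (μ := P) hX.aemeasurable
  exact (Integrable.of_finite (f := u)).comp_measurable hX

theorem integral_mul_of_dependsOn [Nonempty γ] (ha : ∀ t, Measurable (a t)) (hind : iIndepFun a P)
    {F : (ℕ → γ) → ℝ} (hF : DependsOn F (Set.Iio t)) (g : γ → ℝ) :
    ∫ ω, F (fun s => a s ω) * g (a t ω) ∂P
      = (∫ ω, F (fun s => a s ω) ∂P) * ∫ ω, g (a t ω) ∂P := by
  obtain ⟨u, hu⟩ := exists_eq_comp_restrict_of_dependsOn hF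
  simp only [hu]
  have hX : Measurable fun ω => fun i : Finset.range t => a i ω :=
    measurable_pi_lambda _ fun i => ha i
  have h := hind.indepFun_finset (Finset.range t) {t} (by simp) ha
  have h' := h.comp (measurable_of_finite u)
    (measurable_of_finite fun y : (({t} : Finset ℕ) → γ) => g (y ⟨t, Finset.mem_singleton_self t⟩))
  exact h'.integral_mul_eq_mul_integral ((measurable_of_finite u).comp hX).aestronglyMeasurable
    ((measurable_of_finite g).comp (ha t)).aestronglyMeasurable

omit [Fintype γ] in
theorem integral_ite_eq [DecidableEq γ] (ha : Measurable (a t)) (s : γ) :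
    ∫ ω, (if a t ω = s then (1 : ℝ) else 0) ∂P = P.real (a t ⁻¹' {s}) := by
  rw [← integral_indicator_one (ha (measurableSet_singleton s))]
  refine integral_congr_ae (ae_of_all _ fun ω => ?_)
  by_cases h : a t ω = s <;> simp [h]

/-- Averaging over the next choice with the past frozen: a substitute for conditional expectation,
obtained by splitting on the value of `a t`. -/
theorem integral_of_dependsOn_of_next [IsProbabilityMeasure P] [Nonempty γ] (ha : ∀ t, Measurable (a t))
    (hind : iIndepFun a P) {G : (ℕ → γ) → γ → ℝ} (hG : ∀ s, DependsOn (fun x => G x s) (Set.Iio t)) :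
    ∫ ω, G (fun s => a s ω) (a t ω) ∂P
      = ∫ ω, ∑ s, P.real (a t ⁻¹' {s}) * G (fun s => a s ω) s ∂P := by
  classical
  have h1 : ∀ ω, G (fun s => a s ω) (a t ω)
      = ∑ s, G (fun s => a s ω) s * if a t ω = s then (1 : ℝ) else 0 := by
    intro ω
    simp
  have hint : ∀ s, Integrable (fun ω => G (fun s => a s ω) s) P := fun s =>
    integrable_of_dependsOn ha (hG s)
  simp only [h1]
  rw [integral_finsetSum, integral_finsetSum]
  · refine Finset.sum_congr rfl fun s _ => ?_
    rw [integral_mul_of_dependsOn ha hind (hG s) fun x => if x = s then 1 else 0,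
      integral_ite_eq (ha t), integral_const_mul, mul_comm]
  · exact fun s _ => (hint s).const_mul _
  · intro s _
    refine (hint s).mul_bdd (c := 1) ?_ (ae_of_all _ fun ω => ?_)
    · exact ((measurable_of_finite fun x => if x = s then (1 : ℝ) else 0).comp
        (ha t)).aestronglyMeasurable
    · split_ifs <;> simp

section Chain

variable {S : Type*} {step : S → γ → S} {S₀ : S} {it : (ℕ → γ) → ℕ → S}

omit [MeasurableSpace γ] [MeasurableSingletonClass γ] [Fintype γ] in
theorem dependsOn_chain (h0 : ∀ x, it x 0 = S₀) (hs : ∀ x t, it x (t + 1) = step (it x t) (x t))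
    (t : ℕ) : DependsOn (fun x => it x t) (Set.Iio t) := by
  induction t with
  | zero => intro x y _; simp only [h0]
  | succ t ih =>
    intro x y h
    have h1 : it x t = it y t := ih fun i hi => h i (Nat.lt_succ_of_lt hi)
    simp only [hs]
    rw [h1, h t (Nat.lt_succ_self t)]

/-- The one-step contraction is only required on the invariant set `I`; this is where the token
balance will enter. -/
theorem integral_chain_le [IsProbabilityMeasure P] [Nonempty γ] (ha : ∀ t, Measurable (a t))
    (hind : iIndepFun a P) {p : γ → ℝ} (hp : ∀ t s, P.real (a t ⁻¹' {s}) = p s)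
    (h0 : ∀ x, it x 0 = S₀) (hs : ∀ x t, it x (t + 1) = step (it x t) (x t))
    {I : S → Prop} (hI0 : I S₀) (hI : ∀ X s, I X → I (step X s)) {Ψ : S → ℝ} {q : ℝ} (hq : 0 ≤ q)
    (hΨ : ∀ X, I X → ∑ s, p s * Ψ (step X s) ≤ q * Ψ X) (t : ℕ) :
    ∫ ω, Ψ (it (fun s => a s ω) t) ∂P ≤ q ^ t * Ψ S₀ := by
  have hdep := dependsOn_chain h0 hs
  have hinv : ∀ x t, I (it x t) := by
    intro x t
    induction t with
    | zero => rw [h0]; exact hI0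
    | succ t ih => rw [hs]; exact hI _ _ ih
  induction t with
  | zero => simp [h0]
  | succ t ih =>
    have hG : ∀ s, DependsOn (fun x => Ψ (step (it x t) s)) (Set.Iio t) := fun s x y h =>
      congrArg (fun X => Ψ (step X s)) (hdep t h)
    have hF : DependsOn (fun x => Ψ (it x t)) (Set.Iio t) := fun x y h => congrArg Ψ (hdep t h)
    simp only [hs]
    rw [integral_of_dependsOn_of_next ha hind hG]
    simp only [hp]
    calc ∫ ω, ∑ s, p s * Ψ (step (it (fun s => a s ω) t) s) ∂P
        ≤ ∫ ω, q * Ψ (it (fun s => a s ω) t) ∂P := by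
          refine integral_mono ?_ ((integrable_of_dependsOn ha hF).const_mul q)
            fun ω => hΨ _ (hinv _ t)
          exact integrable_finsetSum _ fun s _ => (integrable_of_dependsOn ha (hG s)).const_mul _
      _ = q * ∫ ω, Ψ (it (fun s => a s ω) t) ∂P := integral_const_mul _ _
      _ ≤ q * (q ^ t * Ψ S₀) := by gcongr
      _ = q ^ (t + 1) * Ψ S₀ := by ring

end Chain

end Sampling

/-! ### Hitting times from geometric decay in expectation. -/

section Hitting

variable {Ω : Type*} [MeasurableSpace Ω] {P : Measure Ω} [IsProbabilityMeasure P]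
  {e : ℕ → Ω → ℝ} {C₀ r ε : ℝ} {T : ℕ}

/-- The series is the expected hitting time. Its first `T` terms are at most `1` each; from `T` on,
Markov's inequality gives a geometric tail with sum `1 / r`. -/
theorem tsum_measure_forall_lt_le (hint : ∀ t, Integrable (e t) P) (hpos : ∀ t ω, 0 ≤ e t ω)
    (hr : 0 < r) (hr1 : r ≤ 1) (hε : 0 < ε) (he : ∀ t, ∫ ω, e t ω ∂P ≤ (1 - r) ^ t * C₀)
    (hT : (1 - r) ^ T * C₀ ≤ ε) :
    ∑' t, P {ω | ∀ s ≤ t, ε < e s ω} ≤ ENNReal.ofReal (T + 1 / r) := by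
  have hq : 0 ≤ 1 - r := by linarith
  have hgeo := summable_geometric_of_lt_one hq (by linarith)
  have htail : ∀ t, P {ω | ∀ s ≤ t + T, ε < e s ω} ≤ ENNReal.ofReal ((1 - r) ^ t) := by
    intro t
    have h1 := mul_meas_ge_le_integral_of_nonneg (ae_of_all P (hpos (t + T))) (hint (t + T)) ε
    have h2 : ε * P.real {ω | ε ≤ e (t + T) ω} ≤ ε * (1 - r) ^ t :=
      calc _ ≤ (1 - r) ^ (t + T) * C₀ := h1.trans (he _)
        _ = (1 - r) ^ t * ((1 - r) ^ T * C₀) := by ring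
        _ ≤ (1 - r) ^ t * ε := by gcongr
        _ = _ := mul_comm _ _
    have h3 := le_of_mul_le_mul_left h2 hε
    rw [← ofReal_measureReal (measure_ne_top _ _)]
    refine ENNReal.ofReal_le_ofReal (le_trans (measureReal_mono ?_) h3)
    exact fun ω h => (h (t + T) le_rfl).le
  rw [← ENNReal.summable.sum_add_tsum_nat_add' (k := T),
    ENNReal.ofReal_add (Nat.cast_nonneg T) (by positivity)]
  refine add_le_add ?_ ?_
  · refine (Finset.sum_le_card_nsmul _ _ 1 fun t _ => prob_le_one).trans ?_
    simp
  · refine (ENNReal.tsum_le_tsum htail).trans ?_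
    rw [← ENNReal.ofReal_tsum_of_nonneg (fun t => pow_nonneg hq t) hgeo,
      tsum_geometric_of_lt_one hq (by linarith)]
    simp

-- The event of never reaching `ε` lies in every event of the series, so positive measure would make
-- the sum infinite.
omit [IsProbabilityMeasure P] in
theorem ae_exists_le_of_tsum_ne_top (h : ∑' t, P {ω | ∀ s ≤ t, ε < e s ω} ≠ ∞) :
    ∀ᵐ ω ∂P, ∃ t, e t ω ≤ ε := by
  rw [ae_iff]
  simp only [not_exists, not_le]
  by_contra hne
  refine h (top_le_iff.1 ?_)
  rw [← ENNReal.tsum_const_eq_top_of_ne_zero (α := ℕ) hne]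
  exact ENNReal.tsum_le_tsum fun t => measure_mono fun ω h s _ => h s

theorem exists_time_pow_mul_le (hC : 0 < C₀) (hr : 0 < r) (hr1 : r ≤ 1) (hε : 0 < ε) :
    ∃ T : ℕ, (T : ℝ) ≤ 1 + 1 / r * Real.posLog (C₀ / ε) ∧ (1 - r) ^ T * C₀ ≤ ε := by
  have hpl : 0 ≤ 1 / r * Real.posLog (C₀ / ε) :=
    mul_nonneg (by positivity) Real.posLog_nonneg
  refine ⟨⌈1 / r * Real.posLog (C₀ / ε)⌉₊, ?_, ?_⟩
  · have := (Nat.ceil_lt_add_one hpl).le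
    linarith
  · set T := ⌈1 / r * Real.posLog (C₀ / ε)⌉₊
    have hT : Real.log (C₀ / ε) ≤ r * T := by
      have h1 : 1 / r * Real.posLog (C₀ / ε) ≤ T := Nat.le_ceil _
      rw [div_mul_eq_mul_div, one_mul, div_le_iff₀ hr] at h1
      have h2 : Real.log (C₀ / ε) ≤ Real.posLog (C₀ / ε) := le_max_right _ _
      linarith
    have h3 : (1 - r) ^ T ≤ Real.exp (-(r * T)) := by
      have := pow_le_pow_left₀ (by linarith) (Real.one_sub_le_exp_neg r) T
      rwa [← Real.exp_nat_mul, mul_neg, mul_comm] at this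
    have h4 : Real.exp (-(r * T)) ≤ ε / C₀ := by
      rw [← Real.exp_log (div_pos hε hC), ← inv_div C₀ ε, Real.log_inv]
      exact Real.exp_le_exp.2 (by linarith)
    rw [← le_div_iff₀ hC]
    exact h3.trans h4

end Hitting

/-! ### The Lyapunov function and its expected one-step decrease. -/

section Lyapunov

open scoped RealInnerProductSpace

variable {n d : ℕ}

/-- The dual variable `σ̃ θ + ∇ f z`, centered at its value at the optimum. -/
def dualShift (σt : ℝ) (f : Vec d → ℝ) (θs θ z : Vec d) : Vec d :=
  σt • (θ - θs) + (∇ f z - ∇ f θs)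

/-- The contribution of a node with parameters `θ`, `z` to the Lyapunov function. -/
def nodePotential (σt α s : ℝ) (f : Vec d → ℝ) (θs θ z : Vec d) : ℝ :=
  1 / 2 * ‖dualShift σt f θs θ z‖ ^ 2 + α⁻¹ * bregman f z θs
    + s * (σt / 2 * ‖θ - θs‖ ^ 2 + bregman f θs z)

/-- The Lyapunov function: dual distance to the optimum plus `s` times the dual suboptimality. -/
def potential (σt α s : ℝ) (f : Fin n → Vec d → ℝ) (θs : Vec d) (S : State n 1 d) : ℝ :=
  ∑ i, nodePotential σt α s (f i) θs (S.node i) (S.z i) + s * (σt / 2 * ‖S.token 0 - θs‖ ^ 2)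

/-- The relation between the token and the dual variables of the nodes. -/
def TokenBalance (σt : ℝ) (f : Fin n → Vec d → ℝ) (θs : Vec d) (S : State n 1 d) : Prop :=
  σt • (S.token 0 - θs) + ∑ i, dualShift σt (f i) θs (S.node i) (S.z i) = 0

theorem bregman_sub_bregman_right (f : Vec d → ℝ) (x y z : Vec d) :
    bregman f x z - bregman f x y = bregman f y z + ⟪∇ f z - ∇ f y, y - x⟫ := by
  simp only [bregman, inner_sub_left, inner_sub_right]
  ring

theorem bregman_sub_bregman_left (f : Vec d → ℝ) (x y z : Vec d) :
    bregman f z x - bregman f y x = bregman f z y + ⟪∇ f y - ∇ f x, z - y⟫ := by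
  simp only [bregman, inner_sub_left, inner_sub_right]
  ring

theorem bregman_add_bregman_comm (f : Vec d → ℝ) (x y : Vec d) :
    bregman f x y + bregman f y x = ⟪∇ f x - ∇ f y, x - y⟫ := by
  simp only [bregman, inner_sub_left, inner_sub_right]
  ring

/-- The dual distance gains `s ^ 2 / 2 * ‖w‖ ^ 2`, while averaging `θ` and `τ` lowers the
suboptimality term by `s ^ 2 * (1 - ρ) * ‖w‖ ^ 2`; `ρ ≤ 1 / 2` makes the balance favorable. -/
theorem nodePotential_comm_le {σt α s ρ : ℝ} (f : Vec d → ℝ) (θs θ z τ : Vec d)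
    (hρ : ρ ≤ 1 / 2) (hs : s = σt * ρ) :
    nodePotential σt α s f θs (θ + ρ • (τ - θ)) z
        + s * (σt / 2 * ‖τ - ρ • (τ - θ) - θs‖ ^ 2)
      ≤ nodePotential σt α s f θs θ z + s * (σt / 2 * ‖τ - θs‖ ^ 2)
        + s * ⟪dualShift σt f θs θ z, τ - θ⟫ := by
  set w := τ - θ with hw
  have h1 : dualShift σt f θs (θ + ρ • w) z = dualShift σt f θs θ z + s • w := by
    simp only [dualShift, hs]
    module
  have h2 : θ + ρ • w - θs = (θ - θs) + ρ • w := by abel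
  have h3 : τ - ρ • w - θs = (τ - θs) - ρ • w := by abel
  have h4 : ⟪τ - θs, w⟫ - ⟪θ - θs, w⟫ = ‖w‖ ^ 2 := by
    rw [← inner_sub_left, ← real_inner_self_eq_norm_sq, hw]
    congr 1
    abel
  simp only [nodePotential, h1, h2, h3, norm_add_sq_real, norm_sub_sq_real, inner_smul_right,
    norm_smul, Real.norm_eq_abs, mul_pow, sq_abs]
  have h5 : 0 ≤ s ^ 2 * (1 / 2 - ρ) * ‖w‖ ^ 2 := by
    have : 0 ≤ 1 / 2 - ρ := by linarith
    positivity
  have h6 : ⟪τ - θs, w⟫ = ⟪θ - θs, w⟫ + ‖w‖ ^ 2 := by linarith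
  rw [h6]
  subst hs
  nlinarith

/-- The dual variable does not move. With `D' = bregman f z' z`, the suboptimality falls by at least
`ρ⁻¹ * D'`, and since `s = α⁻¹ * ρ` this pays exactly for the term `α⁻¹ * D'` created in the
divergence of `z`. -/
theorem nodePotential_comp_le {σt α s ρ L : ℝ} {f : Vec d → ℝ} (hf : ConvexSmooth L f)
    (hL : 0 < L) (hσ : 0 < σt) (hρ0 : 0 < ρ) (hs0 : 0 ≤ s) (hs : s = α⁻¹ * ρ)
    (hρ : ρ * (1 + L / σt) ≤ 1) (θs θ z z' : Vec d) (hz' : z' = (1 - ρ) • z + ρ • θ) :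
    nodePotential σt α s f θs (θ - σt⁻¹ • (∇ f z' - ∇ f z)) z'
      ≤ nodePotential σt α s f θs θ z + s * ⟪∇ f z - ∇ f θs, θ - z⟫ := by
  set h := ∇ f z' - ∇ f z with hh
  have h1 : dualShift σt f θs (θ - σt⁻¹ • h) z' = dualShift σt f θs θ z := by
    simp only [dualShift, smul_sub, smul_smul, mul_inv_cancel₀ hσ.ne', hh]
    module
  have h2 : θ - σt⁻¹ • h - θs = (θ - θs) - σt⁻¹ • h := by abel
  have hzz : z' - z = ρ • (θ - z) := by rw [hz']; module
  have hα : α⁻¹ = s * ρ⁻¹ := by rw [hs]; field_simp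
  have hB1 := bregman_sub_bregman_right f θs z z'
  have hB2 := bregman_sub_bregman_left f θs z z'
  have hB3 := bregman_add_bregman_comm f z' z
  have hco := hf.norm_gradient_sub_sq_le hL z z'
  rw [norm_sub_rev, ← hh] at hco
  rw [← hh] at hB1 hB3
  rw [hzz, inner_smul_right] at hB2 hB3
  simp only [nodePotential, h1, h2, norm_sub_sq_real, inner_smul_right, norm_smul,
    Real.norm_eq_abs, mul_pow, sq_abs]
  have hsplit : ⟪h, z - θs⟫ = ⟪h, θ - θs⟫ - ⟪h, θ - z⟫ := by
    rw [← inner_sub_right]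
    congr 1
    abel
  rw [real_inner_comm h (θ - θs)]
  have hpos := hf.bregman_nonneg z z'
  set I := ⟪h, θ - z⟫
  set D := bregman f z z'
  set D' := bregman f z' z
  have hI : I = ρ⁻¹ * (D' + D) := by rw [hB3]; field_simp
  -- Cocoercivity bounds the square of the correction to `θ` by `L / σt * D`; the restriction on `ρ`
  -- then lets `ρ⁻¹ * D` cover it together with the `D` from the Bregman identity.
  have hquad : σt / 2 * (σt⁻¹ ^ 2 * ‖h‖ ^ 2) ≤ L / σt * D := by
    calc σt / 2 * (σt⁻¹ ^ 2 * ‖h‖ ^ 2) ≤ σt / 2 * (σt⁻¹ ^ 2 * (2 * L * D)) := by gcongr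
      _ = _ := by field_simp
  have hρinv : (1 + L / σt) * D ≤ ρ⁻¹ * D := by
    gcongr
    rw [← one_div, le_div_iff₀ hρ0]
    linarith
  have hσσ : σt / 2 * (2 * (σt⁻¹ * ⟪h, θ - θs⟫)) = ⟪h, θ - θs⟫ := by field_simp
  have hkey : σt / 2 * (‖θ - θs‖ ^ 2 - 2 * (σt⁻¹ * ⟪h, θ - θs⟫) + σt⁻¹ ^ 2 * ‖h‖ ^ 2)
      + bregman f θs z' + ρ⁻¹ * D' ≤ σt / 2 * ‖θ - θs‖ ^ 2 + bregman f θs z := by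
    nlinarith
  have hkey' := mul_le_mul_of_nonneg_left hkey hs0
  have hB2' : bregman f z' θs = bregman f z θs + D' + ρ * ⟪∇ f z - ∇ f θs, θ - z⟫ := by linarith
  have hαρ : α⁻¹ * (ρ * ⟪∇ f z - ∇ f θs, θ - z⟫) = s * ⟪∇ f z - ∇ f θs, θ - z⟫ := by
    rw [hs]; ring
  have hαD : α⁻¹ * D' = s * (ρ⁻¹ * D') := by rw [hα]; ring
  rw [hB2', mul_add, mul_add, hαρ, hαD]
  linarith

theorem nodePotential_le_mul {σt α s L : ℝ} {f : Vec d → ℝ} (hf : ConvexSmooth L f)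
    (hL : 0 < L) (hσ : 0 < σt) (hα : 2 ≤ α * (σt + 2 * L)) (hα0 : 0 < α) (hs : 2 * s ≤ σt + 2 * L)
    (θs θ z : Vec d) :
    nodePotential σt α s f θs θ z
      ≤ (σt + 2 * L) * (σt * ‖θ - θs‖ ^ 2 + ⟪∇ f z - ∇ f θs, z - θs⟫) := by
  have h1 := hf.bregman_nonneg z θs
  have h2 := hf.bregman_nonneg θs z
  have h3 := hf.norm_gradient_sub_sq_le hL z θs
  have h4 := bregman_add_bregman_comm f z θs
  rw [← h4]
  have hsq : ‖dualShift σt f θs θ z‖ ^ 2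
      ≤ (σt + 2 * L) * (σt * ‖θ - θs‖ ^ 2 + bregman f z θs) := by
    have ha : ‖dualShift σt f θs θ z‖ ≤ σt * ‖θ - θs‖ + ‖∇ f z - ∇ f θs‖ := by
      refine (norm_add_le _ _).trans ?_
      rw [norm_smul, Real.norm_of_nonneg hσ.le]
    -- Weighted Cauchy–Schwarz, with weights chosen so that `‖∇ f z - ∇ f θs‖ ^ 2 / (2 * L)` is
    -- controlled by the Bregman divergence.
    have hb : (σt * ‖θ - θs‖ + ‖∇ f z - ∇ f θs‖) ^ 2
        ≤ (σt + 2 * L) * (σt * ‖θ - θs‖ ^ 2 + ‖∇ f z - ∇ f θs‖ ^ 2 / (2 * L)) := by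
      set u := ‖θ - θs‖
      set v := ‖∇ f z - ∇ f θs‖
      have : (σt + 2 * L) * (σt * u ^ 2 + v ^ 2 / (2 * L)) - (σt * u + v) ^ 2
          = σt / (2 * L) * (2 * L * u - v) ^ 2 := by
        field_simp
        ring
      have h0 : 0 ≤ σt / (2 * L) * (2 * L * u - v) ^ 2 := by positivity
      linarith
    refine (pow_le_pow_left₀ (norm_nonneg _) ha 2).trans (hb.trans ?_)
    gcongr
    rw [div_le_iff₀ (by positivity)]
    linarith
  have hαi : α⁻¹ ≤ (σt + 2 * L) / 2 := by
    rw [inv_le_iff_one_le_mul₀ hα0]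
    linarith
  have h5 : α⁻¹ * bregman f z θs ≤ (σt + 2 * L) / 2 * bregman f z θs := by gcongr
  have h6 : s * (σt / 2 * ‖θ - θs‖ ^ 2 + bregman f θs z)
      ≤ (σt + 2 * L) / 2 * (σt / 2 * ‖θ - θs‖ ^ 2 + bregman f θs z) := by
    gcongr
    linarith
  unfold nodePotential
  have h7 : 0 ≤ (σt + 2 * L) * (σt * ‖θ - θs‖ ^ 2) := by positivity
  have h8 : 0 ≤ (σt + 2 * L) * bregman f θs z := by positivity
  nlinarith

theorem sum_sub_sum_of_eq_off {g h : Fin n → ℝ} (i : Fin n) (hgh : ∀ j, j ≠ i → g j = h j) :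
    ∑ j, g j = ∑ j, h j + (g i - h i) := by
  rw [← sub_eq_iff_eq_add', ← Finset.sum_sub_distrib]
  exact Finset.sum_eq_single i (fun j _ hj => by rw [hgh j hj, sub_self])
    (fun h => absurd (Finset.mem_univ i) h)

theorem potential_commUpdate_le {σt α s ρ : ℝ} (f : Fin n → Vec d → ℝ) (θs : Vec d)
    (hρ : ρ ≤ 1 / 2) (hs : s = σt * ρ) (S : State n 1 d) (i : Fin n) (k : Fin 1) :
    potential σt α s f θs (commUpdate ρ S i k) ≤ potential σt α s f θs S
      + s * ⟪dualShift σt (f i) θs (S.node i) (S.z i), S.token 0 - S.node i⟫ := by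
  obtain rfl : k = 0 := Subsingleton.elim _ _
  have h := nodePotential_comm_le (α := α) (f i) θs (S.node i) (S.z i) (S.token 0) hρ hs
  unfold potential
  rw [sum_sub_sum_of_eq_off (h := fun j => nodePotential σt α s (f j) θs (S.node j) (S.z j)) i
    fun j hj => by simp [commUpdate, Function.update_of_ne hj]]
  simp only [commUpdate, Function.update_self]
  linarith

theorem potential_compUpdate_le {σt α s ρ L : ℝ} {f : Fin n → Vec d → ℝ}
    (hf : ∀ i, ConvexSmooth L (f i)) (hL : 0 < L) (hσ : 0 < σt) (hρ0 : 0 < ρ) (hs0 : 0 ≤ s)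
    (hs : s = α⁻¹ * ρ) (hρ : ρ * (1 + L / σt) ≤ 1) (θs : Vec d) (S : State n 1 d) (i : Fin n) :
    potential σt α s f θs (compUpdate σt ρ f S i) ≤ potential σt α s f θs S
      + s * ⟪∇ (f i) (S.z i) - ∇ (f i) θs, S.node i - S.z i⟫ := by
  have h := nodePotential_comp_le (hf i) hL hσ hρ0 hs0 hs hρ θs (S.node i) (S.z i) _ rfl
  unfold potential
  rw [sum_sub_sum_of_eq_off (h := fun j => nodePotential σt α s (f j) θs (S.node j) (S.z j)) i
    fun j hj => by simp [compUpdate, Function.update_of_ne hj]]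
  simp only [compUpdate, Function.update_self, zNew]
  linarith

/-- Center every vector at `θs`. The products of the gradient differences with `S.node i - θs`
cancel between the two summands, and the balance relation turns the products with the token into
`-σt * ‖S.token 0 - θs‖ ^ 2`. -/
theorem TokenBalance.sum_inner_eq {σt : ℝ} {f : Fin n → Vec d → ℝ} {θs : Vec d} {S : State n 1 d}
    (h : TokenBalance σt f θs S) :
    ∑ i, (⟪dualShift σt (f i) θs (S.node i) (S.z i), S.token 0 - S.node i⟫
        + ⟪∇ (f i) (S.z i) - ∇ (f i) θs, S.node i - S.z i⟫)
      = -(σt * ‖S.token 0 - θs‖ ^ 2 + ∑ i, (σt * ‖S.node i - θs‖ ^ 2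
        + ⟪∇ (f i) (S.z i) - ∇ (f i) θs, S.z i - θs⟫)) := by
  have h1 : ∑ i, ⟪dualShift σt (f i) θs (S.node i) (S.z i), S.token 0 - θs⟫
      = -(σt * ‖S.token 0 - θs‖ ^ 2) := by
    rw [← sum_inner, eq_neg_of_add_eq_zero_right h, inner_neg_left, real_inner_smul_left,
      real_inner_self_eq_norm_sq]
  rw [neg_add, ← h1, ← Finset.sum_neg_distrib, ← Finset.sum_add_distrib]
  refine Finset.sum_congr rfl fun i _ => ?_
  have h2 : S.token 0 - S.node i = (S.token 0 - θs) - (S.node i - θs) := by abel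
  have h3 : S.node i - S.z i = (S.node i - θs) - (S.z i - θs) := by abel
  rw [h2, h3, inner_sub_right _ (S.token 0 - θs), inner_sub_right _ (S.node i - θs) (S.z i - θs),
    dualShift, inner_add_left _ _ (S.node i - θs),
    real_inner_smul_left, real_inner_self_eq_norm_sq]
  ring

theorem TokenBalance.commUpdate {σt ρ : ℝ} {f : Fin n → Vec d → ℝ} {θs : Vec d} {S : State n 1 d}
    (h : TokenBalance σt f θs S) (i : Fin n) (k : Fin 1) :
    TokenBalance σt f θs (commUpdate ρ S i k) := by
  obtain rfl : k = 0 := Subsingleton.elim _ _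
  unfold TokenBalance at *
  rw [← h, ← sub_eq_zero, add_sub_add_comm, ← Finset.sum_sub_distrib,
    Finset.sum_eq_single i]
  · simp only [TokenGD.commUpdate, Function.update_self, dualShift]
    module
  · intro j _ hj
    simp [TokenGD.commUpdate, Function.update_of_ne hj]
  · simp

theorem TokenBalance.compUpdate {σt ρ : ℝ} (hσ : σt ≠ 0) {f : Fin n → Vec d → ℝ} {θs : Vec d}
    {S : State n 1 d} (h : TokenBalance σt f θs S) (i : Fin n) :
    TokenBalance σt f θs (compUpdate σt ρ f S i) := by
  unfold TokenBalance at *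
  rw [← h, ← sub_eq_zero, add_sub_add_comm, ← Finset.sum_sub_distrib,
    Finset.sum_eq_single i]
  · simp only [TokenGD.compUpdate, Function.update_self, dualShift, smul_sub, smul_smul,
      mul_inv_cancel₀ hσ]
    module
  · intro j _ hj
    simp [TokenGD.compUpdate, Function.update_of_ne hj]
  · simp

theorem sigmaT_pos {σ : ℝ} (hn : 0 < n) (hσ : 0 < σ) : 0 < sigmaT n 1 σ := by
  unfold sigmaT
  positivity

theorem tokenBalance_init {σ : ℝ} (hn : 0 < n) (hσ : 0 < σ) {f : Fin n → Vec d → ℝ} {θs : Vec d}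
    (hθs : ∑ i, ∇ (f i) θs = -((n * σ) • θs)) (z₀ : Fin n → Vec d) :
    TokenBalance (sigmaT n 1 σ) f θs (init 1 σ f z₀) := by
  have h0 := (sigmaT_pos hn hσ).ne'
  have h1 : n * σ = (n + 1) * sigmaT n 1 σ := by
    unfold sigmaT
    push_cast
    field_simp
  have h2 : ∀ i, dualShift (sigmaT n 1 σ) (f i) θs (-((sigmaT n 1 σ)⁻¹ • ∇ (f i) (z₀ i))) (z₀ i)
      = -(sigmaT n 1 σ • θs) - ∇ (f i) θs := by
    intro i
    simp only [dualShift, smul_sub, smul_neg, smul_smul, mul_inv_cancel₀ h0]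
    module
  simp only [TokenBalance, init, h2, Finset.sum_sub_distrib, hθs, Finset.sum_const,
    Finset.card_univ, Fintype.card_fin, h1, ← Nat.cast_smul_eq_nsmul ℝ]
  module

theorem sum_choiceProb_mul_potential_le {σ L α s : ℝ} {f : Fin n → Vec d → ℝ} {θs : Vec d}
    (hn : 0 < n) (hσ : 0 < σ) (hL : 0 < L) (hf : ∀ i, ConvexSmooth L (f i)) (hα0 : 0 < α)
    (hα : 2 ≤ α * (sigmaT n 1 σ + 2 * L))
    (hs1 : s = sigmaT n 1 σ * rhoComm n 1 σ L α (1 / 2) (1 / 2))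
    (hs2 : s = α⁻¹ * rhoComp n 1 σ L α (1 / 2) (1 / 2))
    (hcomm : rhoComm n 1 σ L α (1 / 2) (1 / 2) ≤ 1 / 2)
    (hcomp0 : 0 < rhoComp n 1 σ L α (1 / 2) (1 / 2))
    (hcomp : rhoComp n 1 σ L α (1 / 2) (1 / 2) * (1 + L / sigmaT n 1 σ) ≤ 1)
    {S : State n 1 d} (hS : TokenBalance (sigmaT n 1 σ) f θs S) :
    ∑ x, choiceProb n 1 (1 / 2) (1 / 2) x
        * potential (sigmaT n 1 σ) α s f θs (step σ L α (1 / 2) (1 / 2) f S x)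
      ≤ (1 - s / (2 * n * (sigmaT n 1 σ + 2 * L))) * potential (sigmaT n 1 σ) α s f θs S := by
  have hσt := sigmaT_pos hn hσ
  set σt := sigmaT n 1 σ
  have hs0 : 0 ≤ s := by rw [hs2]; positivity
  have hn' : (0 : ℝ) < n := by exact_mod_cast hn
  have hdiss : potential σt α s f θs S ≤ (σt + 2 * L) * (σt * ‖S.token 0 - θs‖ ^ 2
      + ∑ i, (σt * ‖S.node i - θs‖ ^ 2 + ⟪∇ (f i) (S.z i) - ∇ (f i) θs, S.z i - θs⟫)) := by
    have hs' : 2 * s ≤ σt + 2 * L := by rw [hs1]; nlinarith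
    unfold potential
    rw [mul_add, add_comm, Finset.mul_sum]
    refine add_le_add ?_ (Finset.sum_le_sum fun i _ =>
      nodePotential_le_mul (hf i) hL hσt hα hα0 hs' θs _ _)
    have : 0 ≤ σt * ‖S.token 0 - θs‖ ^ 2 := by positivity
    nlinarith
  have hsum : ∑ x, choiceProb n 1 (1 / 2) (1 / 2) x
        * potential σt α s f θs (step σ L α (1 / 2) (1 / 2) f S x)
      ≤ ∑ i : Fin n, 1 / (2 * n) * (2 * potential σt α s f θs S
        + s * (⟪dualShift σt (f i) θs (S.node i) (S.z i), S.token 0 - S.node i⟫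
        + ⟪∇ (f i) (S.z i) - ∇ (f i) θs, S.node i - S.z i⟫)) := by
    rw [Fintype.sum_sum_type, Fintype.sum_prod_type, ← Finset.sum_add_distrib]
    refine Finset.sum_le_sum fun i _ => ?_
    have h1 := potential_commUpdate_le (α := α) f θs hcomm hs1 S i 0
    have h2 := potential_compUpdate_le hf hL hσt hcomp0 hs0 hs2 hcomp θs S i
    -- With both probabilities equal to `1 / 2`, the communication and the computation choice at a
    -- node have the same weight, so their drifts can be paired.
    have hp1 : (1 / 2 : ℝ) / ((n : ℝ) * ((1 : ℕ) : ℝ)) = 1 / (2 * n) := by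
      push_cast
      field_simp
    have hp2 : (1 / 2 : ℝ) / (n : ℝ) = 1 / (2 * n) := by field_simp
    simp only [Fin.sum_univ_one, choiceProb, step, hp1, hp2]
    rw [← mul_add]
    exact mul_le_mul_of_nonneg_left (by linarith) (by positivity)
  refine hsum.trans ?_
  rw [← Finset.mul_sum, Finset.sum_add_distrib, ← Finset.mul_sum _ _ s, hS.sum_inner_eq,
    Finset.sum_const, Finset.card_univ, Fintype.card_fin, nsmul_eq_mul]
  set Q := σt * ‖S.token 0 - θs‖ ^ 2
      + ∑ i, (σt * ‖S.node i - θs‖ ^ 2 + ⟪∇ (f i) (S.z i) - ∇ (f i) θs, S.z i - θs⟫)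
  set Ψ := potential σt α s f θs S
  have h1 : s / (2 * n * (σt + 2 * L)) * Ψ ≤ s / (2 * n) * Q := by
    calc s / (2 * n * (σt + 2 * L)) * Ψ ≤ s / (2 * n * (σt + 2 * L)) * ((σt + 2 * L) * Q) := by
          gcongr
      _ = _ := by field_simp
  have h2 : 1 / (2 * n) * (n * (2 * Ψ) + s * -Q) = Ψ - s / (2 * n) * Q := by
    field_simp
    ring
  rw [h2]
  linarith

theorem mul_err_le_potential {σt α s L : ℝ} {f : Fin n → Vec d → ℝ} {θs : Vec d}
    (hf : ∀ i, ConvexSmooth L (f i)) (hα : 0 ≤ α) (hs : 0 ≤ s) (S : State n 1 d) :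
    s * σt / 2 * S.err θs ≤ potential σt α s f θs S := by
  unfold State.err potential
  rw [Fin.sum_univ_one, mul_add, Finset.mul_sum]
  refine add_le_add (Finset.sum_le_sum fun i _ => ?_) (le_of_eq (by ring))
  have h1 := (hf i).bregman_nonneg (S.z i) θs
  have h2 := (hf i).bregman_nonneg θs (S.z i)
  have h3 : 0 ≤ 1 / 2 * ‖dualShift σt (f i) θs (S.node i) (S.z i)‖ ^ 2
    + α⁻¹ * bregman (f i) (S.z i) θs + s * bregman (f i) θs (S.z i) := by positivity
  unfold nodePotential
  linarith

end Lyapunov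

/-! ### Size of the step size and of the contraction rate. -/

section Parameters

variable {n : ℕ} {c σ L α : ℝ}

theorem sigmaT_le (hσ : 0 < σ) : sigmaT n 1 σ ≤ σ := by
  unfold sigmaT
  push_cast
  have : (n : ℝ) / (n + 1) ≤ 1 := by
    rw [div_le_one (by positivity)]
    linarith
  nlinarith

theorem half_le_sigmaT (hn : 0 < n) (hσ : 0 < σ) : σ / 2 ≤ sigmaT n 1 σ := by
  have hn' : (1 : ℝ) ≤ n := by exact_mod_cast hn
  unfold sigmaT
  push_cast
  have : 1 / 2 ≤ (n : ℝ) / (n + 1) := by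
    rw [div_le_div_iff₀ (by norm_num) (by positivity)]
    linarith
  nlinarith

theorem eta_le_div (hn : 0 < n) :
    eta n 1 σ L α (1 / 2) (1 / 2) ≤ sigmaT n 1 σ / (4 * n) := by
  have hn' : (0 : ℝ) < n := by exact_mod_cast hn
  refine (min_le_left _ _).trans (le_of_eq ?_)
  push_cast
  field_simp
  norm_num

/-- For `alphaSL` both arguments of the minimum equal `σ̃ / (4 n)`, and the factor `c / (1 + c)` is
mere slack. For `alphaL` the second one is `L / (σ̃ + L)` times this, whence the need for `c * σ ≤
L`. -/
theorem mul_div_le_eta (hn : 0 < n) (hσ : 0 < σ) (hL : 0 < L) (hc : 0 < c)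
    (h : α = alphaL 1 L ∧ c * σ ≤ L ∨ α = alphaSL n 1 σ L) :
    c / (1 + c) * (sigmaT n 1 σ / (4 * n)) ≤ eta n 1 σ L α (1 / 2) (1 / 2) := by
  have hn' : (0 : ℝ) < n := by exact_mod_cast hn
  have hs := sigmaT_pos hn hσ
  have hle := sigmaT_le (n := n) hσ
  have hc1 : c / (1 + c) ≤ 1 := by
    rw [div_le_one (by positivity)]
    linarith
  have hfirst : c / (1 + c) * (sigmaT n 1 σ / (4 * n)) ≤ sigmaT n 1 σ / (4 * n) :=
    mul_le_of_le_one_left (by positivity) hc1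
  refine le_min (hfirst.trans (le_of_eq ?_)) ?_
  · push_cast
    field_simp
    norm_num
  · set σt := sigmaT n 1 σ
    rcases h with ⟨rfl, hcL⟩ | rfl
    · have h1 : (1 / 2 : ℝ) / (n * alphaL 1 L * (1 + L / σt)) = L / (σt + L) * (σt / (4 * n)) := by
        unfold alphaL
        push_cast
        field_simp
        norm_num
      rw [h1]
      refine mul_le_mul_of_nonneg_right ?_ (by positivity)
      rw [div_le_div_iff₀ (by positivity) (by positivity)]
      nlinarith
    · have h1 : (1 / 2 : ℝ) / (n * alphaSL n 1 σ L * (1 + L / σt)) = σt / (4 * n) := by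
        unfold alphaSL
        change _ / (n * (_ / (σt + L)) * _) = _
        push_cast
        field_simp
        norm_num
      rw [h1]
      exact hfirst

theorem alpha_pos (hn : 0 < n) (hσ : 0 < σ) (hL : 0 < L)
    (h : α = alphaL 1 L ∧ c * σ ≤ L ∨ α = alphaSL n 1 σ L) : 0 < α := by
  have hs := sigmaT_pos hn hσ
  rcases h with ⟨rfl, -⟩ | rfl
  · unfold alphaL
    positivity
  · unfold alphaSL
    positivity

theorem two_le_alpha_mul (hn : 0 < n) (hσ : 0 < σ) (hL : 0 < L)
    (h : α = alphaL 1 L ∧ c * σ ≤ L ∨ α = alphaSL n 1 σ L) :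
    2 ≤ α * (sigmaT n 1 σ + 2 * L) := by
  have hs := sigmaT_pos hn hσ
  rcases h with ⟨rfl, -⟩ | rfl
  · unfold alphaL
    rw [div_mul_eq_mul_div, le_div_iff₀ hL]
    push_cast
    linarith
  · unfold alphaSL
    rw [div_mul_eq_mul_div, le_div_iff₀ (by positivity)]
    push_cast
    linarith

/-- The contraction rate of the Lyapunov function. -/
def rate (n : ℕ) (σ L α : ℝ) : ℝ :=
  eta n 1 σ L α (1 / 2) (1 / 2) / (sigmaT n 1 σ + 2 * L)

theorem one_div_rate_le (hn : 0 < n) (hσ : 0 < σ) (hL : 0 < L) (hc : 0 < c)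
    (h : α = alphaL 1 L ∧ c * σ ≤ L ∨ α = alphaSL n 1 σ L) :
    1 / rate n σ L α ≤ (1 + c) / c * (16 * (n * kappa σ L)) := by
  have hn' : (0 : ℝ) < n := by exact_mod_cast hn
  have hs := sigmaT_pos hn hσ
  have hη := mul_div_le_eta hn hσ hL hc h
  have hhalf := half_le_sigmaT hn hσ
  unfold rate kappa
  set σt := sigmaT n 1 σ
  rw [one_div_div]
  calc (σt + 2 * L) / eta n 1 σ L α (1 / 2) (1 / 2)
      ≤ (σt + 2 * L) / (c / (1 + c) * (σt / (4 * n))) := by gcongr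
    _ = (1 + c) / c * (4 * (n * (1 + 2 * (L / σt)))) := by
        field_simp
    _ ≤ (1 + c) / c * (4 * (n * (1 + 2 * (L / (σ / 2))))) := by gcongr
    _ ≤ (1 + c) / c * (4 * (n * (4 * (1 + L / σ)))) := by
        gcongr
        have : L / (σ / 2) = 2 * (L / σ) := by field_simp
        rw [this]
        linarith
    _ = _ := by ring

end Parameters

theorem measurableSingletonClass_choice {n : ℕ} : MeasurableSingletonClass (Choice n 1) where
  measurableSet_singleton s := by
    rw [measurableSet_sum_iff]
    exact ⟨(Set.toFinite _).measurableSet, (Set.toFinite _).measurableSet⟩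

/-! ### Expected numbers of gradient steps and jumps. -/

section Counting

variable {Ω : Type*} [MeasurableSpace Ω] {P : Measure Ω} [IsProbabilityMeasure P] {n : ℕ}
  {a : ℕ → Ω → Choice n 1}

theorem integral_gradSteps (ha : IsSampling P (1 / 2) (1 / 2) a) (i : Fin n) (T : ℕ) :
    ∫ ω, (gradSteps (fun s => a s ω) i T : ℝ) ∂P = T * (1 / 2 / n) := by
  have := measurableSingletonClass_choice (n := n)
  simp only [gradSteps, Finset.card_filter, Nat.cast_sum, Nat.cast_ite, Nat.cast_one, Nat.cast_zero]
  rw [integral_finsetSum]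
  · simp only [integral_ite_eq (ha.meas _), ha.law, choiceProb, Finset.sum_const,
      Finset.card_range, nsmul_eq_mul]
  · intro t _
    have hX := (ha.meas t)
    have := Measure.isProbabilityMeasure_map (μ := P) hX.aemeasurable
    exact (Integrable.of_finite (f := fun x => if x = Sum.inr i then (1 : ℝ) else 0)).comp_measurable
      hX

theorem integral_jumps_le (T : ℕ) : ∫ ω, (jumps (fun s => a s ω) T : ℝ) ∂P ≤ T := by
  have h : ∀ ω, (jumps (fun s => a s ω) T : ℝ) ≤ T := fun ω => by
    have := Finset.card_filter_le (Finset.range T) fun t => (a t ω).isLeft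
    rw [Finset.card_range] at this
    exact_mod_cast this
  calc ∫ ω, (jumps (fun s => a s ω) T : ℝ) ∂P ≤ ∫ _, (T : ℝ) ∂P :=
        integral_mono_of_nonneg (ae_of_all _ fun _ => Nat.cast_nonneg _) (integrable_const _)
          (ae_of_all _ h)
    _ = T := by simp

omit [IsProbabilityMeasure P] in
theorem lintegral_jumpsUntil_le {e : ℕ → Ω → ℝ} {ε : ℝ}
    (hm : ∀ t, MeasurableSet {ω | ∀ s ≤ t, ε < e s ω}) :
    ∫⁻ ω, jumpsUntil (fun s => a s ω) (fun t => e t ω) ε ∂P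
      ≤ ∑' t, P {ω | ∀ s ≤ t, ε < e s ω} := by
  classical
  unfold jumpsUntil
  calc _ ≤ ∫⁻ ω, ∑' t, Set.indicator {ω | ∀ s ≤ t, ε < e s ω} 1 ω ∂P := by
        refine lintegral_mono fun ω => ENNReal.tsum_le_tsum fun t => ?_
        by_cases h : ∀ s ≤ t, ε < e s ω
        · rw [Set.indicator_of_mem (show ω ∈ {ω | ∀ s ≤ t, ε < e s ω} from h)]
          split_ifs <;> simp
        · rw [if_neg fun h' => h h'.1]
          exact zero_le
    _ = _ := by
        rw [lintegral_tsum fun t => (measurable_one.indicator (hm t)).aemeasurable]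
        simp only [lintegral_indicator_one (hm _)]

/-- A form of Wald's identity: not having hit by time `t` is decided by the choices before `t`,
hence independent of the choice made at `t`. -/
theorem lintegral_gradStepsUntil_eq (hn : 0 < n) (ha : IsSampling P (1 / 2) (1 / 2) a)
    {E : ℕ → (ℕ → Choice n 1) → ℝ} (hE : ∀ t, DependsOn (E t) (Set.Iio t)) (ε : ℝ) (i : Fin n) :
    ∫⁻ ω, gradStepsUntil (fun s => a s ω) (fun t => E t fun s => a s ω) ε i ∂P
      = (∑' t, P {ω | ∀ s ≤ t, ε < E s fun r => a r ω}) * ENNReal.ofReal (1 / 2 / n) := by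
  classical
  have := measurableSingletonClass_choice (n := n)
  have : Nonempty (Choice n 1) := ⟨Sum.inr ⟨0, hn⟩⟩
  have hm := measurableSet_forall_lt ha.meas hE ε
  have hm' : ∀ t, MeasurableSet (a t ⁻¹' {Sum.inr i}) := fun t =>
    ha.meas t (measurableSet_singleton _)
  have heq : ∀ t ω, (if (∀ s ≤ t, ε < E s fun r => a r ω) ∧ a t ω = Sum.inr i then (1 : ℝ≥0∞) else 0)
      = Set.indicator ({ω | ∀ s ≤ t, ε < E s fun r => a r ω} ∩ a t ⁻¹' {Sum.inr i}) 1 ω := by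
    intro t ω
    simp [Set.indicator_apply]
  unfold gradStepsUntil
  simp only [heq]
  rw [lintegral_tsum fun t => (measurable_one.indicator ((hm t).inter (hm' t))).aemeasurable,
    ← ENNReal.tsum_mul_right]
  refine tsum_congr fun t => ?_
  rw [lintegral_indicator_one ((hm t).inter (hm' t))]
  have hdep : DependsOn (fun x => if ∀ s ≤ t, ε < E s x then (1 : ℝ) else 0) (Set.Iio t) := by
    intro x y hxy
    have : ∀ s ≤ t, E s x = E s y := fun s hs => hE s fun j hj => hxy j (lt_of_lt_of_le hj hs)
    have h2 : (∀ s ≤ t, ε < E s x) ↔ ∀ s ≤ t, ε < E s y :=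
      forall₂_congr fun s hs => by rw [this s hs]
    simp only [h2]
  have h := integral_mul_of_dependsOn ha.meas ha.indep hdep
    fun x => if x = Sum.inr i then 1 else 0
  have h1 : ∫ ω, (if ∀ s ≤ t, ε < E s fun r => a r ω then (1 : ℝ) else 0) ∂P
      = P.real {ω | ∀ s ≤ t, ε < E s fun r => a r ω} := by
    rw [← integral_indicator_one (hm t)]
    exact integral_congr_ae (ae_of_all _ fun ω => by simp [Set.indicator_apply])
  have h2 : ∫ ω, (if ∀ s ≤ t, ε < E s fun r => a r ω then (1 : ℝ) else 0)
        * (if a t ω = Sum.inr i then 1 else 0) ∂P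
      = P.real ({ω | ∀ s ≤ t, ε < E s fun r => a r ω} ∩ a t ⁻¹' {Sum.inr i}) := by
    rw [← integral_indicator_one ((hm t).inter (hm' t))]
    refine integral_congr_ae (ae_of_all _ fun ω => ?_)
    by_cases h3 : a t ω = Sum.inr i <;> simp [Set.indicator_apply, h3]
  rw [h1, h2, integral_ite_eq (ha.meas t), ha.law] at h
  rw [← ofReal_measureReal (measure_ne_top _ _), h, ENNReal.ofReal_mul measureReal_nonneg,
    ofReal_measureReal (measure_ne_top _ _)]
  rfl

end Counting

/-! ### Geometric decay of the expected error. -/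

theorem err_nonneg {n K d : ℕ} (S : State n K d) (θs : Vec d) : 0 ≤ S.err θs := by
  unfold State.err
  positivity

theorem integral_err_le {n d : ℕ} {c σ L α : ℝ} (hn : 0 < n) (hσ : 0 < σ) (hL : 0 < L)
    (hc : 0 < c) (hα : α = alphaL 1 L ∧ c * σ ≤ L ∨ α = alphaSL n 1 σ L) {f : Fin n → Vec d → ℝ}
    (hf : ∀ i, ConvexSmooth L (f i)) {θs : Vec d} (hmin : IsMinOn (objective σ f) Set.univ θs)
    (z₀ : Fin n → Vec d) :
    0 < rate n σ L α ∧ rate n σ L α ≤ 1 ∧ ∃ C₀ : ℝ, 0 < C₀ ∧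
      ∀ (Ω : Type*) [MeasurableSpace Ω] (P : Measure Ω) [IsProbabilityMeasure P]
        (a : ℕ → Ω → Choice n 1), IsSampling P (1 / 2) (1 / 2) a → ∀ t,
        ∫ ω, (iterate σ L α (1 / 2) (1 / 2) f z₀ (fun s => a s ω) t).err θs ∂P
          ≤ (1 - rate n σ L α) ^ t * C₀ := by
  have hn' : (1 : ℝ) ≤ n := by exact_mod_cast hn
  have hσt := sigmaT_pos hn hσ
  have hα0 := alpha_pos hn hσ hL hα
  have hη : 0 < eta n 1 σ L α (1 / 2) (1 / 2) :=
    lt_of_lt_of_le (by positivity) (mul_div_le_eta hn hσ hL hc hα)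
  have hη1 : eta n 1 σ L α (1 / 2) (1 / 2) ≤ sigmaT n 1 σ / (4 * n) := eta_le_div hn
  have hη2 : eta n 1 σ L α (1 / 2) (1 / 2) ≤ 1 / 2 / (n * α * (1 + L / sigmaT n 1 σ)) :=
    min_le_right _ _
  have hrate : 0 < rate n σ L α := by unfold rate; positivity
  have hrate1 : rate n σ L α ≤ 1 := by
    unfold rate
    rw [div_le_one (by positivity)]
    have : sigmaT n 1 σ / (4 * n) ≤ sigmaT n 1 σ := div_le_self hσt.le (by linarith)
    linarith
  have hcomm : rhoComm n 1 σ L α (1 / 2) (1 / 2)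
      = 2 * n * eta n 1 σ L α (1 / 2) (1 / 2) / sigmaT n 1 σ := by
    unfold rhoComm
    push_cast
    field_simp
  have hcomp : rhoComp n 1 σ L α (1 / 2) (1 / 2)
      = 2 * n * α * eta n 1 σ L α (1 / 2) (1 / 2) := by
    unfold rhoComp
    field_simp
  have hr : rate n σ L α = 2 * n * eta n 1 σ L α (1 / 2) (1 / 2)
      / (2 * n * (sigmaT n 1 σ + 2 * L)) := by
    unfold rate
    field_simp
  set η := eta n 1 σ L α (1 / 2) (1 / 2)
  set s := 2 * n * η with hs
  have hs0 : 0 < s := by positivity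
  have hstep : ∀ S : State n 1 d, TokenBalance (sigmaT n 1 σ) f θs S →
      ∑ x, choiceProb n 1 (1 / 2) (1 / 2) x
        * potential (sigmaT n 1 σ) α s f θs (step σ L α (1 / 2) (1 / 2) f S x)
      ≤ (1 - rate n σ L α) * potential (sigmaT n 1 σ) α s f θs S := by
    intro S hS
    rw [hr]
    refine sum_choiceProb_mul_potential_le hn hσ hL hf hα0 (two_le_alpha_mul hn hσ hL hα)
      ?_ ?_ ?_ ?_ ?_ hS
    · rw [hcomm]
      field_simp
    · rw [hcomp, hs]
      field_simp
    · rw [hcomm, div_le_iff₀ hσt]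
      rw [le_div_iff₀ (by positivity)] at hη1
      linarith
    · rw [hcomp]
      positivity
    · rw [hcomp]
      rw [le_div_iff₀ (by positivity)] at hη2
      linarith
  refine ⟨hrate, hrate1,
    -- The prefactor converts potential into error; the `+ 1` keeps `C₀` positive even when the
    -- initial potential vanishes.
    2 / (s * sigmaT n 1 σ) * potential (sigmaT n 1 σ) α s f θs (init 1 σ f z₀) + 1, ?_, ?_⟩
  · have : 0 ≤ potential (sigmaT n 1 σ) α s f θs (init 1 σ f z₀) :=
      le_trans (mul_nonneg (by positivity) (err_nonneg _ θs)) (mul_err_le_potential hf hα0.le hs0.le _)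
    positivity
  · intro Ω _ P _ a ha t
    have := measurableSingletonClass_choice (n := n)
    have : Nonempty (Choice n 1) := ⟨Sum.inr ⟨0, hn⟩⟩
    have h0 : ∀ x, iterate σ L α (1 / 2) (1 / 2) f z₀ x 0 = init 1 σ f z₀ := fun _ => rfl
    have h1 : ∀ (x : ℕ → Choice n 1) (t : ℕ), iterate σ L α (1 / 2) (1 / 2) f z₀ x (t + 1)
        = step σ L α (1 / 2) (1 / 2) f (iterate σ L α (1 / 2) (1 / 2) f z₀ x t) (x t) :=
      fun _ _ => rfl
    have hdep := dependsOn_chain h0 h1 t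
    have hmain := integral_chain_le ha.meas ha.indep ha.law h0 h1
      (I := TokenBalance (sigmaT n 1 σ) f θs)
      (tokenBalance_init hn hσ (sum_gradient_of_isMinOn (fun i => (hf i).diff) hmin) z₀)
      (fun X x hX => by
        rcases x with ⟨i, k⟩ | i
        · exact hX.commUpdate i k
        · exact hX.compUpdate hσt.ne' i)
      (sub_nonneg.2 hrate1) hstep t
    calc ∫ ω, (iterate σ L α (1 / 2) (1 / 2) f z₀ (fun s => a s ω) t).err θs ∂P
        ≤ ∫ ω, 2 / (s * sigmaT n 1 σ) * potential (sigmaT n 1 σ) α s f θs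
            (iterate σ L α (1 / 2) (1 / 2) f z₀ (fun s => a s ω) t) ∂P := by
          refine integral_mono (integrable_of_dependsOn ha.meas
            fun x y h => congrArg (fun X => State.err X θs) (hdep h))
            ((integrable_of_dependsOn ha.meas fun x y h => congrArg
              (fun X => potential (sigmaT n 1 σ) α s f θs X) (hdep h)).const_mul _) fun ω => ?_
          have := mul_err_le_potential (σt := sigmaT n 1 σ) (θs := θs) hf hα0.le hs0.le
            (iterate σ L α (1 / 2) (1 / 2) f z₀ (fun s => a s ω) t)
          refine le_trans (le_of_eq ?_) (mul_le_mul_of_nonneg_left this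
            (show 0 ≤ 2 / (s * sigmaT n 1 σ) by positivity))
          field_simp
      _ = 2 / (s * sigmaT n 1 σ) * ∫ ω, potential (sigmaT n 1 σ) α s f θs
            (iterate σ L α (1 / 2) (1 / 2) f z₀ (fun s => a s ω) t) ∂P := integral_const_mul _ _
      _ ≤ 2 / (s * sigmaT n 1 σ) * ((1 - rate n σ L α) ^ t
            * potential (sigmaT n 1 σ) α s f θs (init 1 σ f z₀)) := by gcongr
      _ = (1 - rate n σ L α) ^ t * (2 / (s * sigmaT n 1 σ)
            * potential (sigmaT n 1 σ) α s f θs (init 1 σ f z₀)) := by ring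
      _ ≤ _ := mul_le_mul_of_nonneg_left (by linarith) (pow_nonneg (sub_nonneg.2 hrate1) t)

end TokenGD

end

/-! ### From the contraction rate to the complexity bounds. -/

theorem theorem1 (c : ℝ) (hc : 0 < c) :
    ∃ C : ℝ, 0 < C ∧
      ∀ (n d : ℕ) (σ L α : ℝ), 0 < n → 0 < σ → 0 < L →
      (α = TokenGD.alphaL 1 L ∧ c * σ ≤ L ∨ α = TokenGD.alphaSL n 1 σ L) →
      ∀ f : Fin n → TokenGD.Vec d → ℝ, (∀ i, TokenGD.ConvexSmooth L (f i)) →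
      ∀ θs : TokenGD.Vec d, IsMinOn (TokenGD.objective σ f) Set.univ θs →
      ∀ z₀ : Fin n → TokenGD.Vec d,
      ∃ C₀ : ℝ, 0 < C₀ ∧
        ∀ (Ω : Type*) [MeasurableSpace Ω] (P : Measure Ω) [IsProbabilityMeasure P]
          (a : ℕ → Ω → TokenGD.Choice n 1), TokenGD.IsSampling P (1 / 2) (1 / 2) a →
        ∀ err : ℕ → Ω → ℝ,
          (∀ t ω, err t ω =
            (TokenGD.iterate σ L α (1 / 2) (1 / 2) f z₀ (fun s => a s ω) t).err θs) →
        ∀ ε : ℝ, 0 < ε →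
          -- error at most `ε` in expectation, after a fixed number `T` of iterations
          (∃ T : ℕ,
            (∀ t, T ≤ t → Integrable (err t) P ∧ ∫ ω, err t ω ∂P ≤ ε) ∧
            (∀ i, ∫ ω, (TokenGD.gradSteps (fun s => a s ω) i T : ℝ) ∂P
              ≤ C * TokenGD.kappa σ L * (1 + Real.posLog (C₀ / ε))) ∧
            ∫ ω, (TokenGD.jumps (fun s => a s ω) T : ℝ) ∂P
              ≤ C * (n * TokenGD.kappa σ L) * (1 + Real.posLog (C₀ / ε))) ∧
          -- error at most `ε` on the trajectory, counting until the first time this happens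
          (∀ᵐ ω ∂P, ∃ t, err t ω ≤ ε) ∧
          (∀ i, ∫⁻ ω, TokenGD.gradStepsUntil (fun s => a s ω) (fun t => err t ω) ε i ∂P
            ≤ ENNReal.ofReal (C * TokenGD.kappa σ L * (1 + Real.posLog (C₀ / ε)))) ∧
          ∫⁻ ω, TokenGD.jumpsUntil (fun s => a s ω) (fun t => err t ω) ε ∂P
            ≤ ENNReal.ofReal (C * (n * TokenGD.kappa σ L) * (1 + Real.posLog (C₀ / ε))) := by
 
  -- `17 = 16 + 1`: the inverse rate contributes `16`, and rounding `T` up to an integer costs at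
  -- most `1 ≤ D * (n * κ)`.
  refine ⟨17 * ((1 + c) / c), by positivity, ?_⟩
  intro n d σ L α hn hσ hL hα f hf θs hmin z₀
  obtain ⟨hr, hr1, C₀, hC₀, hbound⟩ := TokenGD.integral_err_le hn hσ hL hc hα hf hmin z₀
  refine ⟨C₀, hC₀, ?_⟩
  intro Ω _ P _ a ha err herr ε hε
  have := TokenGD.measurableSingletonClass_choice (n := n)
  have : Nonempty (TokenGD.Choice n 1) := ⟨Sum.inr ⟨0, hn⟩⟩
  have hinv := TokenGD.one_div_rate_le hn hσ hL hc hα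
  set r := TokenGD.rate n σ L α
  obtain ⟨T, hT, hTε⟩ := TokenGD.exists_time_pow_mul_le hC₀ hr hr1 hε
  have hpl : 0 ≤ Real.posLog (C₀ / ε) := Real.posLog_nonneg
  set ℓ := Real.posLog (C₀ / ε)
  have hn' : (1 : ℝ) ≤ n := by exact_mod_cast hn
  have hκ : 1 ≤ TokenGD.kappa σ L := by
    unfold TokenGD.kappa
    have : 0 ≤ L / σ := by positivity
    linarith
  set κ := TokenGD.kappa σ L
  set D := (1 + c) / c with hD
  have hD1 : 1 ≤ D := by
    rw [hD, le_div_iff₀ hc]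
    linarith
  have hDnκ : 1 ≤ D * (n * κ) := one_le_mul_of_one_le_of_one_le hD1
    (one_le_mul_of_one_le_of_one_le hn' hκ)
  have hTr : T + 1 / r ≤ 17 * D * (n * κ) * (1 + ℓ) := by
    have := mul_le_mul_of_nonneg_right hinv hpl
    nlinarith
  have hTle : (T : ℝ) ≤ 17 * D * (n * κ) * (1 + ℓ) := by
    have : 0 < 1 / r := by positivity
    linarith
  -- Division by `n` removes the factor `n` from the bound for a single node; the remaining factor
  -- `1 / 2` is discarded.
  have hnode : ∀ x : ℝ, 0 ≤ x → x ≤ 17 * D * (n * κ) * (1 + ℓ) →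
      x * (1 / 2 / n) ≤ 17 * D * κ * (1 + ℓ) := by
    intro x hx0 hx
    calc x * (1 / 2 / n) ≤ x / n := by
          rw [div_eq_mul_inv x, div_eq_mul_inv (1 / 2 : ℝ)]
          have : 0 ≤ (n : ℝ)⁻¹ := by positivity
          gcongr
          linarith
      _ ≤ 17 * D * (n * κ) * (1 + ℓ) / n := by gcongr
      _ = 17 * D * κ * (1 + ℓ) := by field_simp
  obtain rfl : err = fun t ω =>
      (TokenGD.iterate σ L α (1 / 2) (1 / 2) f z₀ (fun s => a s ω) t).err θs :=
    funext fun t => funext fun ω => herr t ω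
  set E : ℕ → (ℕ → TokenGD.Choice n 1) → ℝ := fun t x =>
    (TokenGD.iterate σ L α (1 / 2) (1 / 2) f z₀ x t).err θs
  have hE : ∀ t, DependsOn (E t) (Set.Iio t) := fun t x y h =>
    congrArg (fun X => TokenGD.State.err X θs)
      (TokenGD.dependsOn_chain (S₀ := TokenGD.init 1 σ f z₀)
        (step := TokenGD.step σ L α (1 / 2) (1 / 2) f)
        (it := TokenGD.iterate σ L α (1 / 2) (1 / 2) f z₀) (fun _ => rfl) (fun _ _ => rfl) t h)
  have hint : ∀ t, Integrable (fun ω => E t fun s => a s ω) P := fun t =>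
    TokenGD.integrable_of_dependsOn ha.meas (hE t)
  have hexp : ∀ t, ∫ ω, E t (fun s => a s ω) ∂P ≤ (1 - r) ^ t * C₀ := hbound Ω P a ha
  have hsum := TokenGD.tsum_measure_forall_lt_le hint (fun t ω => TokenGD.err_nonneg _ θs)
    hr hr1 hε hexp hTε
  refine ⟨⟨T, fun t ht => ⟨hint t, (hexp t).trans (le_trans ?_ hTε)⟩, fun i => ?_,
    (TokenGD.integral_jumps_le T).trans hTle⟩, ?_, fun i => ?_, ?_⟩
  · exact mul_le_mul_of_nonneg_right
      (pow_le_pow_of_le_one (by linarith) (by linarith) ht) hC₀.le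
  · rw [TokenGD.integral_gradSteps ha]
    exact hnode T (Nat.cast_nonneg T) hTle
  · exact TokenGD.ae_exists_le_of_tsum_ne_top (ne_top_of_le_ne_top ENNReal.ofReal_ne_top hsum)
  · rw [TokenGD.lintegral_gradStepsUntil_eq hn ha hE ε i]
    refine (mul_le_mul_left hsum _).trans ?_
    rw [← ENNReal.ofReal_mul (by positivity)]
    exact ENNReal.ofReal_le_ofReal (hnode _ (by positivity) hTr)
  · exact (TokenGD.lintegral_jumpsUntil_le
      (TokenGD.measurableSet_forall_lt ha.meas hE ε)).trans
      (hsum.trans (ENNReal.ofReal_le_ofReal hTr))
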